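/- **Setting.** Let $M=\mathbb{R}^3$, $G,\gamma>0$, $b=8\pi G\gamma$. Let $\mathcal A$ (resp. $\mathcal A^{\mathbb C}$) be the space of smooth $\mathrm{SU}(2)$ (resp. $\mathrm{SL}(2,\mathbb C)$) connections $A^i_a$ on $M$, with components in the basis $\tau_i=-\tfrac i2\sigma_i$, and $\Gamma$ the set of pairs $(A^i_a,\tilde E^a_i)$ with $A\in\mathcal A$ and $\tilde E$ a smooth densitized triad. The Euclidean group acts on $\Gamma$ by motions $y\mapsto ry+v$ combined with the constant gauge rotation $r$; $\Gamma_S\subset\Gamma$ is the set of invariant pairs. Fix $\ell_o>0$, an invariant $\mathring A\in\mathcal A$, $\mathring A\ne0$, and the triad $\mathring e$ with $\mathring e^a_i\mathring A^j_a=\ell_o^{-1}\delta^j_i$, with metric $\mathring q$. A point of $\Gamma_S$ has coordinates $(c,p)\in\mathbb R^2$ with $A=c\mathring A$, $\tilde E=p\,\ell_o^{-2}\sqrt{\mathring q}\,\mathring e$. *Cylindrical functions.* $\underline{\mathrm{Cyl}}$ is the space of functions $\Phi(A)=F(A(e_1),\dots,A(e_n))$ on $\mathcal A$, where $e_1,\dots,e_n$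 are straight edges, $A(e)$ is the holonomy, and $F:\mathrm{SU}(2)^n\to\mathbb C$ is real analytic. With $r(c)=c\mathring A$, $\mathrm{Cyl}_S=r^*[\underline{\mathrm{Cyl}}]$, a space of functions on $\mathbb R$. A star denotes the algebraic dual. *Complexifiers.* Let $C=C[\tilde E]\ge0$ and $C_S=C_S(p)\ge 0$ be functions of the momenta only, where $\delta C/\delta\tilde E$ exists (as a smooth field, for compactly supported variations) at all symmetric $\tilde E$, $C_S$ is differentiable, and $\delta C/\delta\tilde E$ and $C_S'$ vanish at zero momentum and only there. Put $\mathfrak Z[\xi]=A-ib\,\frac{\delta C}{\delta\tilde E}(\tilde E)$ for $\xi=(A,\tilde E)$ and $z[\xi]=c-i\frac b3C_S'(p)$ for $\xi\in\Gamma_S$. Assume that there is a holomorphic $s:\mathbb C\to\mathcal A^{\mathbb C}$ with $s(z[\xi])=\mathfrak Z[\xi]$ for all $\xi\in\Gamma_S$. Let $\hat C$ be a non-negative self-adjoint operator (the quantization of $C$) on $L^2(\overline{\mathcal A},\mu^o)$, where $\overline{\mathcal A}$ is the space of generalized connections and $\mu^o$ the Ashtekar–Lewandowski measure, and assume that $e^{-\hat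 C}$ maps $\underline{\mathrm{Cyl}}$ into itself. Let $\hat C_S=C_S(\hat p)$ with $\hat p=-i\frac b3\frac{d}{dc}$, so that $e^{-\hat C_S}e^{i\omega c}=e^{-C_S(b\omega/3)}e^{i\omega c}$. *Holomorphic transforms.* Assume that for $\Phi\in\underline{\mathrm{Cyl}}$ the function $e^{-\hat C}\Phi$ on $\mathcal A$ has a continuation $U\Phi$ to $\mathcal A^{\mathbb C}$ of the form $\tilde F(\mathfrak Z(e_1),\dots,\mathfrak Z(e_n))$ with $e_i$ straight and $\tilde F:\mathrm{SL}(2,\mathbb C)^n\to\mathbb C$ holomorphic, and that for $\phi\in\mathrm{Cyl}_S$ the function $e^{-\hat C_S}\phi$ on $\mathbb R$ has an entire continuation $U_S\phi$. The coherent state with label $\mathfrak Z$ is the functional $(\Psi^C_{\mathfrak Z}|\Phi\rangle=(U\Phi)(\mathfrak Z)$. Assume finally that $s^*U[\underline{\mathrm{Cyl}}]\subseteq U_S[\mathrm{Cyl}_S]$, so that $\pi=U_S^{-1}\circ s^*\circ U:\underline{\mathrm{Cyl}}\to\mathrm{Cyl}_S$ is defined on $\underline{\mathrm{Cyl}}$.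 The b-embedding is $\iota_b:\mathrm{Cyl}_S^*\to\underline{\mathrm{Cyl}}^*$, $(\iota_b\alpha)(\Phi)=\alpha(\pi\Phi)$. **Proposition.** The map $\pi$ is linear (so $\iota_b$ is well defined), the coherent states $(\Psi^C_{\mathfrak Z[\xi]}|$, $\xi\in\Gamma_S$, are linear functionals on $\underline{\mathrm{Cyl}}$, and the image of $\iota_b$ is precisely $$\operatorname{Im}\iota_b=\Big\{\Psi\in\underline{\mathrm{Cyl}}^*\ \Big|\ \forall\Phi\in\underline{\mathrm{Cyl}}:\ (U\Phi)|_{\mathfrak Z[\Gamma_S]}=0\ \Rightarrow\ \Psi(\Phi)=0\Big\}.$$ Equivalently, $\Psi\in\operatorname{Im}\iota_b$ if and only if $\Psi(\Phi)=0$ for every $\Phi\in\underline{\mathrm{Cyl}}$ such that $(\Psi^C_{\mathfrak Z[\xi]}|\Phi\rangle=0$ for all $\xi\in\Gamma_S$. -/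

import Mathlib

open MeasureTheory Filter Topology
open scoped ContDiff

noncomputable section

namespace BEmbedding

/-! ### Connections, triads and the Euclidean group -/

/-- The spatial manifold `ℝ³` in Cartesian coordinates. -/
abbrev Space := Fin 3 → ℝ

/-- Smooth fields `x ↦ (X x i a)`, with internal index `i` and spatial index `a`. -/
def SmoothField (𝕜 : Type) [RCLike 𝕜] : Submodule 𝕜 (Space → Fin 3 → Fin 3 → 𝕜) where
  carrier := {X | ContDiff ℝ ∞ X}
  add_mem' := by
    intro X Y hX hY
    exact ContDiff.add (𝕜 := ℝ) (n := ∞) hX hY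
  zero_mem' := by
    show ContDiff ℝ ∞ (fun _ : Space => (0 : Fin 3 → Fin 3 → 𝕜))
    exact contDiff_const
  smul_mem' := by
    intro c X hX
    exact ContDiff.const_smul (𝕜 := ℝ) (n := ∞) c hX

/-- Smooth `SU(2)` connections, `A x i a = A^i_a(x)`, components in the basis `τ_i`. -/
abbrev Conn := SmoothField ℝ

/-- Smooth densitized triads, `E x i a = E^a_i(x)`. -/
abbrev Triad := SmoothField ℝ

/-- Smooth `SL(2,ℂ)` connections. -/
abbrev ConnC := SmoothField ℂ

/-- The inclusion of real fields in complex ones. -/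
def toC (X : SmoothField ℝ) : ConnC :=
  ⟨fun x i a => (X.1 x i a : ℂ), by
    have h : ContDiff ℝ ∞ X.1 := X.2
    exact contDiff_pi.2 fun i => contDiff_pi.2 fun a =>
      Complex.ofRealCLM.contDiff.comp (contDiff_pi.1 (contDiff_pi.1 h i) a)⟩

/-- The Euclidean motion `φ_{(v,r)} : y ↦ r y + v` together with the constant gauge rotation
`r`, acting on a field: `(r^i_j (φ_* X)^j_a)`.  Since `r` is orthogonal with determinant one the
formula is the same for connections and for densitized triads. -/
def euclAct (v : Space) (r : Matrix.specialOrthogonalGroup (Fin 3) ℝ)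
    (X : Space → Fin 3 → Fin 3 → ℝ) : Space → Fin 3 → Fin 3 → ℝ :=
  fun y i a => ∑ j, ∑ b, r.1 i j * r.1 a b * X (r.1.transpose.mulVec (y - v)) j b

/-- Invariance of a field under the whole Euclidean group. -/
def IsSymmetric (X : SmoothField ℝ) : Prop :=
  ∀ v r, euclAct v r X.1 = X.1

/-- The symmetric phase space `Γ_S`: the invariant pairs `(A, E)`. -/
def symPhase : Set (Conn × Triad) :=
  {ξ | IsSymmetric ξ.1 ∧ IsSymmetric ξ.2}

/-- The reference triad `e^a_i` with `e^a_i A₀^j_a = ℓ⁻¹ δ^j_i`; the entry is `(a, i)`. -/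
def refTriad (ℓ : ℝ) (A₀ : Conn) (x : Space) : Matrix (Fin 3) (Fin 3) ℝ :=
  ℓ⁻¹ • (Matrix.of (A₀.1 x))⁻¹

/-- The densitized reference triad `√q e^a_i`, where `q` is the metric with orthonormal frame
`e_i`, so that `√q = |det e|⁻¹`. -/
def refDensTriad (ℓ : ℝ) (A₀ : Conn) : Space → Fin 3 → Fin 3 → ℝ :=
  fun x i a => |(refTriad ℓ A₀ x).det|⁻¹ * refTriad ℓ A₀ x a i

/-- `(c, p)` are the coordinates of `ξ`: `A = c A₀` and `E = p ℓ⁻² √q e`. -/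
def HasCoords (ℓ : ℝ) (A₀ : Conn) (ξ : Conn × Triad) (c p : ℝ) : Prop :=
  ξ.1 = c • A₀ ∧ ∀ x i a, ξ.2.1 x i a = p * (ℓ ^ 2)⁻¹ * refDensTriad ℓ A₀ x i a

/-! ### Holonomies along straight edges and cylindrical functions -/

/-- The basis `τ_i = -(i/2) σ_i` of `su(2)`. -/
def tau : Fin 3 → Matrix (Fin 2) (Fin 2) ℂ :=
  ![(-(Complex.I / 2)) • !![0, 1; 1, 0],
    (-(Complex.I / 2)) • !![0, -Complex.I; Complex.I, 0],
    (-(Complex.I / 2)) • !![1, 0; 0, -1]]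

/-- An oriented straight edge from `src` to `tgt`. -/
structure Edge where
  src : Space
  tgt : Space
  ne : src ≠ tgt

/-- The affine parametrization of a straight edge on `[0,1]`. -/
def Edge.param (e : Edge) (t : ℝ) : Space := e.src + t • (e.tgt - e.src)

/-- The `sl(2,ℂ)` element `Z^i_a(e(t)) ė^a τ_i`. -/
def pullback (Z : ConnC) (e : Edge) (t : ℝ) : Matrix (Fin 2) (Fin 2) ℂ :=
  ∑ i, ∑ a, (Z.1 (e.param t) i a * ((e.tgt a - e.src a : ℝ) : ℂ)) • tau i

/-- Parallel transport along `e`: `h' = Z(ė) h`, `h(0) = 1`. -/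
def IsTransport (Z : ConnC) (e : Edge) (h : ℝ → Matrix (Fin 2) (Fin 2) ℂ) : Prop :=
  h 0 = 1 ∧ ∀ t j k, HasDerivAt (fun u => h u j k) ((pullback Z e t * h t) j k) t

open Classical in
/-- The holonomy `Z(e)`: the value at `1` of the (unique) parallel transport along `e`. -/
def hol (Z : ConnC) (e : Edge) : Matrix (Fin 2) (Fin 2) ℂ :=
  if h : ∃ h, IsTransport Z e h then h.choose 1 else 1

/-- `n`-tuples of complex `2 × 2` matrices, as a normed space. -/
abbrev Tuple (n : ℕ) := Fin n → Fin 2 → Fin 2 → ℂ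

/-- `SU(2)ⁿ` inside the tuples of matrices. -/
def SUn (n : ℕ) : Set (Tuple n) :=
  {g | ∀ i, Matrix.of (g i) ∈ Matrix.specialUnitaryGroup (Fin 2) ℂ}

/-- `SL(2,ℂ)ⁿ` inside the tuples of matrices. -/
def SLn (n : ℕ) : Set (Tuple n) :=
  {g | ∀ i, (Matrix.of (g i)).det = 1}

/-- `Φ(A) = F(A(e₁), …, A(eₙ))` with `F` real analytic on `SU(2)ⁿ`; a function on this compact
submanifold is real analytic iff it is the restriction of one that is real analytic near it. -/
def IsRep (Φ : Conn → ℂ) {n : ℕ} (e : Fin n → Edge) (F : Tuple n → ℂ) : Prop :=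
  AnalyticOnNhd ℝ F (SUn n) ∧ ∀ A : Conn, Φ A = F fun i => hol (toC A) (e i)

/-- The straight-edge cylindrical functions on the space of smooth connections. -/
def StraightCyl : Submodule ℂ (Conn → ℂ) where
  carrier := {Φ | ∃ (n : ℕ) (e : Fin n → Edge) (F : Tuple n → ℂ), IsRep Φ e F}
  zero_mem' := ⟨0, Fin.elim0, fun _ => 0, fun _ _ => analyticAt_const, fun _ => rfl⟩
  smul_mem' := by
    rintro c Φ ⟨n, e, F, hF, h⟩
    exact ⟨n, e, fun g => c * F g, fun g hg => analyticAt_const.mul (hF g hg),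
      fun A => by simp [h A]⟩
  add_mem' := by
    rintro Φ₁ Φ₂ ⟨n, e, F, hF, h⟩ ⟨m, e', F', hF', h'⟩
    let L : Tuple (n + m) →L[ℝ] Tuple n :=
      ContinuousLinearMap.pi fun i => ContinuousLinearMap.proj (Fin.castAdd m i)
    let L' : Tuple (n + m) →L[ℝ] Tuple m :=
      ContinuousLinearMap.pi fun i => ContinuousLinearMap.proj (Fin.natAdd n i)
    refine ⟨n + m, Fin.append e e', fun g => F (L g) + F' (L' g), fun g hg => ?_, fun A => ?_⟩
    · exact ((hF (L g) fun i => hg _).comp (L.analyticAt g)).add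
        ((hF' (L' g) fun i => hg _).comp (L'.analyticAt g))
    · simp only [Pi.add_apply, h A, h' A]
      congr 2
      · funext i
        show _ = hol (toC A) (Fin.append e e' (Fin.castAdd m i))
        rw [Fin.append_left]
      · funext i
        show _ = hol (toC A) (Fin.append e e' (Fin.natAdd n i))
        rw [Fin.append_right]

/-- `c ↦ c A₀`. -/
def rMap (A₀ : Conn) (c : ℝ) : Conn := c • A₀

/-- The reduced cylindrical functions `Cyl_S = r^*[straight-edge Cyl]`. -/
def CylS (A₀ : Conn) : Submodule ℂ (ℝ → ℂ) :=
  StraightCyl.map (LinearMap.funLeft ℂ ℂ (rMap A₀))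

/-! ### The kinematical Hilbert space `L²(𝒜̄, μ°)` -/

/-- Analytic with nowhere vanishing velocity on `[a,b]`. -/
def IsAnalyticArc (γ : ℝ → Space) (a b : ℝ) : Prop :=
  AnalyticOn ℝ γ (Set.Icc a b) ∧
    ∀ t ∈ Set.Icc a b, derivWithin γ (Set.Icc a b) t ≠ 0

/-- Piecewise analytic curves, parametrized by `[0,1]` (values outside are irrelevant). -/
structure Curve where
  toFun : ℝ → Space
  piecewise : ∃ (n : ℕ) (t : Fin (n + 2) → ℝ), StrictMono t ∧ t 0 = 0 ∧ t (Fin.last _) = 1 ∧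
    ∀ i : Fin (n + 1), IsAnalyticArc toFun (t i.castSucc) (t i.succ)

/-- `e'` is an orientation preserving reparametrization of `e`. -/
def IsReparam (e e' : Curve) : Prop :=
  ∃ φ : ℝ → ℝ, ContinuousOn φ (Set.Icc 0 1) ∧ StrictMonoOn φ (Set.Icc 0 1) ∧ φ 0 = 0 ∧ φ 1 = 1 ∧
    ∀ t ∈ Set.Icc (0 : ℝ) 1, e'.toFun t = e.toFun (φ t)

/-- `e = e₂ ∘ e₁`: first `e₁`, then `e₂`. -/
def IsComp (e e₁ e₂ : Curve) : Prop :=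
  ∀ t ∈ Set.Icc (0 : ℝ) 1, e.toFun (t / 2) = e₁.toFun t ∧ e.toFun ((t + 1) / 2) = e₂.toFun t

/-- `e' = e⁻¹`. -/
def IsReverse (e e' : Curve) : Prop :=
  ∀ t ∈ Set.Icc (0 : ℝ) 1, e'.toFun t = e.toFun (1 - t)

/-- The group `SU(2)`. -/
abbrev SU2 := Matrix.specialUnitaryGroup (Fin 2) ℂ

instance : MeasurableSpace SU2 := borel SU2

/-- Generalized connections: morphisms from the groupoid of piecewise analytic curves to
`SU(2)`. -/
def GenConn : Type :=
  {A : Curve → SU2 // (∀ e e', IsReparam e e' → A e' = A e) ∧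
    (∀ e e₁ e₂, IsComp e e₁ e₂ → A e = A e₂ * A e₁) ∧
    (∀ e e', IsReverse e e' → A e' = (A e)⁻¹)}

/-- The σ-algebra generated by the holonomies. -/
instance : MeasurableSpace GenConn := inferInstanceAs (MeasurableSpace (Subtype _))

/-- The edges of a graph: embedded analytic arcs meeting at most in end points. -/
def IsGraph {n : ℕ} (e : Fin n → Curve) : Prop :=
  (∀ i, IsAnalyticArc (e i).toFun 0 1 ∧ Set.InjOn (e i).toFun (Set.Icc 0 1)) ∧
    ∀ i j, i ≠ j → ∀ s ∈ Set.Icc (0 : ℝ) 1, ∀ t ∈ Set.Icc (0 : ℝ) 1,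
      (e i).toFun s = (e j).toFun t → (s = 0 ∨ s = 1) ∧ (t = 0 ∨ t = 1)

/-- The characterization of the Ashtekar–Lewandowski measure: for every graph the joint law of
the holonomies is the normalized Haar measure of `SU(2)ⁿ`, i.e. the left invariant probability. -/
def IsALMeasure (μ : Measure GenConn) : Prop :=
  IsProbabilityMeasure μ ∧ ∀ (n : ℕ) (e : Fin n → Curve), IsGraph e →
    (μ.map fun A : GenConn => fun i => A.1 (e i)).IsMulLeftInvariant

open Classical in
/-- The Ashtekar–Lewandowski measure. -/
def alMeasure : Measure GenConn :=
  if h : ∃ μ, IsALMeasure μ then h.choose else 0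

/-- The kinematical Hilbert space. -/
abbrev KinHilbert := Lp ℂ 2 alMeasure

/-- A straight edge as a piecewise analytic curve. -/
def Edge.toCurve (e : Edge) : Curve where
  toFun := e.param
  piecewise := by
    have hd : ∀ t, HasDerivAt e.param (e.tgt - e.src) t := fun t => by
      have h := ((hasDerivAt_id t).smul_const (e.tgt - e.src)).const_add e.src
      rw [one_smul] at h
      exact h
    refine ⟨0, ![0, 1], ?_, rfl, rfl, fun i => ?_⟩
    · intro i j hij
      fin_cases i <;> fin_cases j <;> simp_all
    · fin_cases i
      refine ⟨?_, fun t ht => ?_⟩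
      · intro t _
        have : AnalyticAt ℝ e.param t :=
          analyticAt_const.add (analyticAt_id.smul analyticAt_const)
        exact this.analyticWithinAt
      · have hu : UniqueDiffWithinAt ℝ (Set.Icc (0 : ℝ) 1) t :=
          uniqueDiffOn_Icc one_pos t (by simpa using ht)
        have := (hd t).hasDerivWithinAt.derivWithin hu
        simp only [Fin.zero_eta, Fin.castSucc_zero, Matrix.cons_val_zero, Fin.succ_zero_eq_one,
          Matrix.cons_val_one]
        rw [this]
        exact sub_ne_zero.2 e.ne.symm

/-- `ψ` is the cylindrical function `Φ`, extended to generalized connections, as an element of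
the kinematical Hilbert space. -/
def IsState (Φ : StraightCyl) (ψ : KinHilbert) : Prop :=
  ∃ (n : ℕ) (e : Fin n → Edge) (F : Tuple n → ℂ), IsRep Φ.1 e F ∧
    (ψ : GenConn → ℂ) =ᵐ[alMeasure] fun A => F fun i => ((A.1 (e i).toCurve : SU2).1 : _)

/-- `ψ' = e^{-C} ψ` for a non-negative self-adjoint operator `C`: `ψ'` is the value at time `1`
of the solution of `u' = -C u`, `u(0) = ψ`. -/
def IsExpNeg (C : KinHilbert →ₗ.[ℂ] KinHilbert) (ψ ψ' : KinHilbert) : Prop :=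
  ∃ u : ℝ → KinHilbert, u 0 = ψ ∧ u 1 = ψ' ∧ ContinuousOn u (Set.Icc 0 1) ∧
    ∀ t ∈ Set.Ioo (0 : ℝ) 1, ∃ h : u t ∈ C.domain, HasDerivAt u (-(C ⟨u t, h⟩)) t

/-- A non-negative self-adjoint operator. -/
def IsNonnegSelfAdjoint (C : KinHilbert →ₗ.[ℂ] KinHilbert) : Prop :=
  IsSelfAdjoint C ∧ ∀ ψ : C.domain, 0 ≤ (inner ℂ (ψ : KinHilbert) (C ψ)).re

/-- `T` is the restriction of `e^{-C}` to the straight-edge cylindrical functions. -/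
def IsExpNegOnCyl (C : KinHilbert →ₗ.[ℂ] KinHilbert)
    (T : StraightCyl →ₗ[ℂ] StraightCyl) : Prop :=
  ∀ Φ, ∃ ψ ψ', IsState Φ ψ ∧ IsState (T Φ) ψ' ∧ IsExpNeg C ψ ψ'

/-! ### Classical complexifiers depending on the momentum only -/

/-- A non-negative functional of the densitized triad, given through its contributions `C R` from
an increasing exhaustion of space (so that functionals such as the total volume, which are
infinite on homogeneous fields, are included; a finite functional is a constant family). -/
structure Complexifier where
  toFun : ℝ → Triad → ℝ
  nonneg : ∀ R E, 0 ≤ toFun R E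
  mono : ∀ E, Monotone fun R => toFun R E

/-- `D = δC/δE` at `E`: for every compactly supported variation `f`, the derivative of `C` in the
direction `f` is `∫ D^i_a f^a_i`. -/
def HasFuncDeriv (C : Complexifier) (E : Triad) (D : Conn) : Prop :=
  ∀ f : Triad, HasCompactSupport f.1 →
    (∀ᶠ R in atTop, DifferentiableAt ℝ (fun t : ℝ => C.toFun R (E + t • f)) 0) ∧
    Tendsto (fun R => deriv (fun t : ℝ => C.toFun R (E + t • f)) 0) atTop
      (𝓝 (∫ x, ∑ i, ∑ a, D.1 x i a * f.1 x i a))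

open Classical in
/-- The functional derivative `δC/δE`. -/
def funcDeriv (C : Complexifier) (E : Triad) : Conn :=
  if h : ∃ D, HasFuncDeriv C E D then h.choose else 0

/-- The complex coordinate `𝔷 = A - i b δC/δE` on phase space, `b = 8πGγ`. -/
def frakZ (b : ℝ) (C : Complexifier) (ξ : Conn × Triad) : ConnC :=
  toC ξ.1 - (Complex.I * (b : ℂ)) • toC (funcDeriv C ξ.2)

/-- The complex coordinate `z = c - i (b/3) C_S'(p)` on the reduced phase space. -/
def redZ (b : ℝ) (CS : ℝ → ℝ) (c p : ℝ) : ℂ :=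
  (c : ℂ) - Complex.I * ((b / 3 * deriv CS p : ℝ) : ℂ)

/-- `s` is the inclusion of the symmetric phase space, `s(z[ξ]) = 𝔷[ξ]`, and is holomorphic. -/
def IsHolInclusion (b ℓ : ℝ) (A₀ : Conn) (C : Complexifier) (CS : ℝ → ℝ) (s : ℂ → ConnC) : Prop :=
  (∀ ξ ∈ symPhase, ∀ c p, HasCoords ℓ A₀ ξ c p → s (redZ b CS c p) = frakZ b C ξ) ∧
    ∀ x i a, Differentiable ℂ fun z => (s z).1 x i a

/-! ### Holomorphic representations -/

/-- Holomorphic cylindrical functions `Z ↦ F(Z(e₁), …, Z(eₙ))` (straight edges), with `F`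
holomorphic on `SL(2,ℂ)ⁿ`, i.e. the restriction of a function holomorphic near it. -/
def IsHolCyl (Ψ : ConnC → ℂ) : Prop :=
  ∃ (n : ℕ) (e : Fin n → Edge) (F : Tuple n → ℂ),
    AnalyticOnNhd ℂ F (SLn n) ∧ ∀ Z : ConnC, Ψ Z = F fun i => hol Z (e i)

/-- `Ψ` is the analytic continuation of `Φ` from real to complex connections. -/
def IsContinuation (Φ : Conn → ℂ) (Ψ : ConnC → ℂ) : Prop :=
  IsHolCyl Ψ ∧ ∀ A : Conn, Ψ (toC A) = Φ A

open Classical in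
/-- The holomorphic transform `(UΦ)(𝔷) = (e^{-Ĉ}Φ)(A')_{A' → 𝔷}`; `T` is `e^{-Ĉ}`. -/
def holU (T : StraightCyl →ₗ[ℂ] StraightCyl) (Φ : StraightCyl) : ConnC → ℂ :=
  if h : ∃ Ψ, IsContinuation (T Φ).1 Ψ then h.choose else 0

/-- The coherent state `(Ψ^C_𝔷 |` on straight-edge cylindrical functions. -/
def coherentState (T : StraightCyl →ₗ[ℂ] StraightCyl) (Z : ConnC) : StraightCyl → ℂ :=
  fun Φ => holU T Φ Z

/-- The component of `φ` along `e^{iwc}` in `L²` of the Bohr compactification of `ℝ`. -/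
def bohrCoeff (φ : ℝ → ℂ) (w : ℝ) : ℂ :=
  limUnder atTop fun R : ℝ =>
    ((2 * R : ℝ) : ℂ)⁻¹ * ∫ c in (-R)..R, φ c * Complex.exp (-(Complex.I * w * c))

/-- `e^{-C_S(p̂)} φ` for `p̂ = -i (b/3) d/dc`, which has the eigenvectors `e^{iwc}` with
eigenvalues `bw/3`. -/
def expNegS (b : ℝ) (CS : ℝ → ℝ) (φ : ℝ → ℂ) : ℝ → ℂ := fun c =>
  ∑' w : ℝ, (Real.exp (-CS (b * w / 3)) : ℂ) * bohrCoeff φ w * Complex.exp (Complex.I * w * c)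

/-- `f` is the entire continuation of `φ`. -/
def IsEntireExtension (φ : ℝ → ℂ) (f : ℂ → ℂ) : Prop :=
  Differentiable ℂ f ∧ ∀ c : ℝ, f c = φ c

open Classical in
/-- The reduced holomorphic transform `(U_S φ)(z) = (e^{-Ĉ_S}φ)(c')_{c' → z}`. -/
def holUS (b : ℝ) (CS : ℝ → ℝ) (φ : ℝ → ℂ) : ℂ → ℂ :=
  if h : ∃ f, IsEntireExtension (expNegS b CS φ) f then h.choose else 0

/-! ### The b-embedding -/

open Classical in
/-- `π = U_S⁻¹ ∘ s^* ∘ U`. -/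
def piMap (b : ℝ) (A₀ : Conn) (CS : ℝ → ℝ) (T : StraightCyl →ₗ[ℂ] StraightCyl) (s : ℂ → ConnC)
    (Φ : StraightCyl) : CylS A₀ :=
  if h : ∃ φ : CylS A₀, holUS b CS φ.1 = fun z => holU T Φ (s z) then h.choose else 0

/-- The b-embedding `ι_b : Cyl_S^* → (straight-edge Cyl)^*`, `(ι_b α)(Φ) = α(π Φ)`. -/
def iotaB {A₀ : Conn} {P : StraightCyl → CylS A₀} (hP : IsLinearMap ℂ P) :
    Module.Dual ℂ (CylS A₀) →ₗ[ℂ] Module.Dual ℂ StraightCyl :=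
  (hP.mk' P).dualMap

end BEmbedding

end

/-! The b-embedding is the transpose of `π`, and over a field the range of a transpose is the
annihilator of the kernel. So everything reduces to two facts: `π` is linear, and `π Φ = 0` exactly
when `U Φ` vanishes on all labels of symmetric points.

Both follow by restricting to a real line. An invariant connection is `k δ^i_a`, and at zero
momentum the imaginary part of the label vanishes. Hence `s c = c A₀` for real `c`, and the identity
theorem gives `s z = z A₀` (`IsHolInclusion.eq_smul`). Along this complex line `U Φ` is entire
(`IsHolCyl.differentiable_smul`), so it is determined by its values `(e^{-Ĉ} Φ)(c A₀)` at real `c`,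
which are linear in `Φ`. Every symmetric point has its label on the line, and the points `(c A₀, 0)`
fill the real part, so vanishing on all labels is the same as vanishing for real `c`.

It remains to see that `e^{-Ĉ_S}` is injective on `Cyl_S`. The holonomy of `c A₀` along a straight
edge is trigonometric in `c`, so an element of `Cyl_S` is a smooth function on a torus restricted to
a line. Its Fourier series converges absolutely and gives an absolutely convergent almost periodic
series (`exists_hasBohrSeries_of_mem_CylS`). Its coefficients are recovered as means
(`HasBohrSeries.bohrCoeff`), and `e^{-Ĉ_S}` multiplies each by a positive number
(`expNegS_injective`). -/

noncomputable section

/-! ### Absolute convergence of Fourier series of smooth functions on the torus -/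

namespace TorusFourier

open UnitAddTorus

variable {d : Type*}

/-- The covering map `ℝᵈ → 𝕋ᵈ`. -/
def proj (x : d → ℝ) : UnitAddTorus d := fun j => (x j : UnitAddCircle)

theorem isOpenQuotientMap_proj : IsOpenQuotientMap (proj : (d → ℝ) → UnitAddTorus d) :=
  IsOpenQuotientMap.piMap fun _ => QuotientAddGroup.isOpenQuotientMap_mk

theorem proj_add_single [DecidableEq d] (x : d → ℝ) (j : d) (h : ℝ) :
    proj x + Pi.single j (h : UnitAddCircle) = proj (x + Pi.single j h) := by
  ext i
  rcases eq_or_ne i j with rfl | hij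
  · simp [proj]
  · simp [proj, hij]

theorem hasDerivAt_add_single [DecidableEq d] (x : d → ℝ) (j : d) (h : ℝ) :
    HasDerivAt (fun h : ℝ => x + Pi.single j h) (Pi.single j (1 : ℝ)) h := by
  rw [hasDerivAt_pi]
  intro i
  rcases eq_or_ne i j with rfl | hij
  · simpa using (hasDerivAt_id h).const_add (x i)
  · simpa [hij] using hasDerivAt_const h (x i)

variable [Fintype d]

theorem mFourier_proj (m : d → ℤ) (x : d → ℝ) :
    mFourier m (proj x) = Complex.exp (2 * Real.pi * Complex.I * ∑ j, m j * x j) := by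
  simp only [mFourier, proj, ContinuousMap.coe_mk, fourier_coe_apply]
  push_cast
  rw [Finset.mul_sum, Complex.exp_sum]
  exact Finset.prod_congr rfl fun j _ => by simp; ring_nf

/-- Smooth functions on the torus, i.e. those with a smooth lift. -/
def IsSmooth (f : UnitAddTorus d → ℂ) : Prop := ContDiff ℝ ∞ fun x => f (proj x)

theorem IsSmooth.continuous {f : UnitAddTorus d → ℂ} (hf : IsSmooth f) : Continuous f :=
  isOpenQuotientMap_proj.isQuotientMap.continuous_iff.2 (ContDiff.continuous hf)

theorem mFourierCoeff_eq (f : UnitAddTorus d → ℂ) (m : d → ℤ) :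
    mFourierCoeff f m =
      ∫ t, mFourier (-m) t * f t ∂(Measure.pi fun _ : d => AddCircle.haarAddCircle) := rfl

theorem IsSmooth.integrable {f : UnitAddTorus d → ℂ} (hf : IsSmooth f) (m : d → ℤ) :
    Integrable (fun t => mFourier m t * f t)
      (Measure.pi fun _ : d => AddCircle.haarAddCircle) :=
  ((mFourier m).continuous.mul hf.continuous).integrable_of_hasCompactSupport
    (HasCompactSupport.of_compactSpace _)

theorem norm_mFourier_mul_le (m : d → ℤ) (t : UnitAddTorus d) (z : ℂ) :
    ‖mFourier m t * z‖ ≤ ‖z‖ := by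
  have h1 : ‖mFourier m t‖ ≤ 1 := by
    simpa [mFourier_norm] using (mFourier m).norm_coe_le_norm t
  rw [norm_mul]
  exact mul_le_of_le_one_left (norm_nonneg z) h1

variable [DecidableEq d]

/-- The partial derivative in the direction `j`. -/
def partialDeriv (j : d) (f : UnitAddTorus d → ℂ) (θ : UnitAddTorus d) : ℂ :=
  deriv (fun h : ℝ => f (θ + Pi.single j (h : UnitAddCircle))) 0

theorem IsSmooth.partialDeriv_proj {f : UnitAddTorus d → ℂ} (hf : IsSmooth f) (j : d)
    (x : d → ℝ) :
    partialDeriv j f (proj x) = fderiv ℝ (fun x => f (proj x)) x (Pi.single j 1) := by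
  have hd : DifferentiableAt ℝ (fun x => f (proj x)) (x + Pi.single j 0) :=
    (ContDiff.differentiable hf (by simp)).differentiableAt
  have h := hd.hasFDerivAt.comp_hasDerivAt (0 : ℝ) (hasDerivAt_add_single x j 0)
  unfold partialDeriv
  simp only [proj_add_single]
  simpa [Function.comp_def] using h.deriv

theorem IsSmooth.partialDeriv {f : UnitAddTorus d → ℂ} (hf : IsSmooth f) (j : d) :
    IsSmooth (partialDeriv j f) := by
  unfold IsSmooth
  simp only [hf.partialDeriv_proj]
  exact (ContDiff.fderiv_right hf (m := ∞) (by simp)).clm_apply contDiff_const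

theorem IsSmooth.hasDerivAt_translate {f : UnitAddTorus d → ℂ} (hf : IsSmooth f) (j : d)
    (θ : UnitAddTorus d) (h : ℝ) :
    HasDerivAt (fun h : ℝ => f (θ + Pi.single j (h : UnitAddCircle)))
      (TorusFourier.partialDeriv j f (θ + Pi.single j (h : UnitAddCircle))) h := by
  obtain ⟨x, rfl⟩ := isOpenQuotientMap_proj.surjective θ
  simp only [proj_add_single, hf.partialDeriv_proj]
  have hd : DifferentiableAt ℝ (fun x => f (proj x)) (x + Pi.single j h) :=
    (ContDiff.differentiable hf (by simp)).differentiableAt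
  exact hd.hasFDerivAt.comp_hasDerivAt h (hasDerivAt_add_single x j h)

theorem mFourier_add_single (m : d → ℤ) (j : d) (t : UnitAddTorus d) (h : ℝ) :
    mFourier m (t + Pi.single j (h : UnitAddCircle)) =
      Complex.exp (2 * Real.pi * Complex.I * m j * h) * mFourier m t := by
  have key : ∀ i, fourier (m i) ((t + Pi.single j (h : UnitAddCircle) : UnitAddTorus d) i) =
      (if i = j then Complex.exp (2 * Real.pi * Complex.I * m j * h) else 1) *
        fourier (m i) (t i) := by
    intro i
    rcases eq_or_ne i j with rfl | hij
    · have h1 : fourier (m i) (t i + (h : UnitAddCircle)) =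
          fourier (m i) (t i) * fourier (m i) (h : UnitAddCircle) := by
        simp only [fourier_apply, smul_add, AddCircle.toCircle_add, Circle.coe_mul]
      simp only [Pi.add_apply, Pi.single_eq_same, h1, fourier_coe_apply, if_true]
      simp [mul_comm]
    · simp [hij]
  simp only [mFourier, ContinuousMap.coe_mk, key, Finset.prod_mul_distrib]
  simp

/-- By invariance of Haar measure, translation moves onto the character. Differentiating at `h = 0`
then yields the coefficients of a partial derivative without integration by parts. -/
theorem integral_mFourier_mul_translate (f : UnitAddTorus d → ℂ) (j : d) (m : d → ℤ) (h : ℝ) :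
    ∫ t, mFourier (-m) t * f (t + Pi.single j (h : UnitAddCircle))
        ∂(Measure.pi fun _ : d => AddCircle.haarAddCircle) =
      Complex.exp (2 * Real.pi * Complex.I * m j * h) * mFourierCoeff f m := by
  have e : Complex.exp (2 * Real.pi * Complex.I * m j * h) *
      Complex.exp (2 * Real.pi * Complex.I * ((-m) j : ℤ) * h) = 1 := by
    rw [← Complex.exp_add, Complex.exp_eq_one_iff]
    exact ⟨0, by push_cast [Pi.neg_apply]; ring⟩
  rw [mFourierCoeff_eq, ← integral_add_right_eq_self (fun t => mFourier (-m) t * f t)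
    (Pi.single j (h : UnitAddCircle)), ← integral_const_mul]
  refine integral_congr_ae (Eventually.of_forall fun t => ?_)
  simp only [mFourier_add_single]
  linear_combination -(mFourier (-m) t * f (t + Pi.single j (h : UnitAddCircle))) * e

theorem IsSmooth.hasDerivAt_integral_translate {f : UnitAddTorus d → ℂ} (hf : IsSmooth f) (j : d)
    (m : d → ℤ) :
    HasDerivAt (fun h : ℝ => ∫ t, mFourier (-m) t * f (t + Pi.single j (h : UnitAddCircle))
        ∂(Measure.pi fun _ : d => AddCircle.haarAddCircle))
      (mFourierCoeff (TorusFourier.partialDeriv j f) m) 0 := by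
  have hgc : Continuous (TorusFourier.partialDeriv j f) := (hf.partialDeriv j).continuous
  obtain ⟨K, hK⟩ := isCompact_univ.exists_bound_of_continuousOn hgc.continuousOn
  let F : ℝ → UnitAddTorus d → ℂ := fun h t =>
    mFourier (-m) t * f (t + Pi.single j (h : UnitAddCircle))
  let F' : ℝ → UnitAddTorus d → ℂ := fun h t =>
    mFourier (-m) t * TorusFourier.partialDeriv j f (t + Pi.single j (h : UnitAddCircle))
  have hF : ∀ h, Continuous (F h) := fun h =>
    (mFourier (-m)).continuous.mul (hf.continuous.comp (continuous_add_const _))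
  have hF' : ∀ h, Continuous (F' h) := fun h =>
    (mFourier (-m)).continuous.mul (hgc.comp (continuous_add_const _))
  have hF0 : F 0 = fun t => mFourier (-m) t * f t := by simp [F]
  have hF0' : F' 0 = fun t => mFourier (-m) t * TorusFourier.partialDeriv j f t := by simp [F']
  have hbound : ∀ t h, ‖F' h t‖ ≤ K := fun t h =>
    (norm_mFourier_mul_le _ _ _).trans (hK _ (Set.mem_univ _))
  have hdiff : ∀ t h, HasDerivAt (F · t) (F' h t) h := fun t h =>
    (hf.hasDerivAt_translate j t h).const_mul _
  rw [mFourierCoeff_eq, ← hF0']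
  have hint : Integrable (F 0) (Measure.pi fun _ : d => AddCircle.haarAddCircle) := by
    rw [hF0]; exact hf.integrable (-m)
  exact (hasDerivAt_integral_of_dominated_loc_of_deriv_le (bound := fun _ => K) univ_mem
    (Eventually.of_forall fun h => (hF h).aestronglyMeasurable) hint
    (hF' 0).aestronglyMeasurable (Eventually.of_forall fun t h _ => hbound t h)
    (integrable_const K) (Eventually.of_forall fun t h _ => hdiff t h)).2

theorem IsSmooth.mFourierCoeff_partialDeriv {f : UnitAddTorus d → ℂ} (hf : IsSmooth f) (j : d)
    (m : d → ℤ) :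
    mFourierCoeff (TorusFourier.partialDeriv j f) m =
      2 * Real.pi * Complex.I * m j * mFourierCoeff f m := by
  have hder := hf.hasDerivAt_integral_translate j m
  simp only [integral_mFourier_mul_translate] at hder
  have h1 : HasDerivAt (fun h : ℝ => 2 * Real.pi * Complex.I * m j * (h : ℂ))
      (2 * Real.pi * Complex.I * m j * 1) 0 :=
    (Complex.ofRealCLM.hasDerivAt (x := (0 : ℝ))).const_mul _
  refine hder.unique ?_
  simpa using h1.cexp.mul_const (mFourierCoeff f m)

/-- `g` is `f` acted on by `1 - ∂_j²` for each `j ∈ s`. These multipliers are at least one, and with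
all directions included their inverses are summable over the lattice. -/
theorem IsSmooth.exists_mFourierCoeff_mul {f : UnitAddTorus d → ℂ} (hf : IsSmooth f)
    (s : Finset d) :
    ∃ g, IsSmooth g ∧ ∀ m, mFourierCoeff g m =
      (∏ j ∈ s, (1 + (2 * Real.pi * m j) ^ 2 : ℝ) : ℝ) * mFourierCoeff f m := by
  induction s using Finset.induction_on with
  | empty => exact ⟨f, hf, by simp⟩
  | insert j s hj ih =>
    obtain ⟨g, hg, h⟩ := ih
    have h2 := (hg.partialDeriv j).partialDeriv j
    refine ⟨fun t => g t - TorusFourier.partialDeriv j (TorusFourier.partialDeriv j g) t,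
      ContDiff.sub hg h2, fun m => ?_⟩
    have : mFourierCoeff
        (fun t => g t - TorusFourier.partialDeriv j (TorusFourier.partialDeriv j g) t) m =
        mFourierCoeff g m -
          mFourierCoeff (TorusFourier.partialDeriv j (TorusFourier.partialDeriv j g)) m := by
      simp only [mFourierCoeff_eq, mul_sub]
      exact integral_sub (hg.integrable _) (h2.integrable _)
    rw [this, (hg.partialDeriv j).mFourierCoeff_partialDeriv, hg.mFourierCoeff_partialDeriv, h,
      Finset.prod_insert hj]
    push_cast
    linear_combination (-(2 * Real.pi * m j) ^ 2 * (∏ j ∈ s, (1 + (2 * Real.pi * m j) ^ 2) : ℂ) *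
      mFourierCoeff f m) * Complex.I_sq

/-- A finite set of indices lies in a box, over which the sum of products factors into a product of
sums. -/
theorem summable_pi_prod {α : Type*} {a : α → ℝ} (h0 : ∀ k, 0 ≤ a k) (ha : Summable a) :
    Summable fun m : d → α => ∏ j, a (m j) := by
  classical
  refine summable_of_sum_le (c := ∏ _j : d, ∑' k, a k)
    (fun m => Finset.prod_nonneg fun j _ => h0 _) fun u => ?_
  calc ∑ m ∈ u, ∏ j, a (m j)
      ≤ ∑ m ∈ Fintype.piFinset fun j => u.image fun m => m j, ∏ j, a (m j) := by
        refine Finset.sum_le_sum_of_subset_of_nonneg (fun m hm => ?_)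
          fun m _ _ => Finset.prod_nonneg fun j _ => h0 _
        exact Fintype.mem_piFinset.2 fun j => Finset.mem_image_of_mem _ hm
    _ = ∏ j : d, ∑ k ∈ u.image fun m => m j, a k := by
        rw [Finset.prod_univ_sum]
    _ ≤ ∏ _j : d, ∑' k, a k :=
        Finset.prod_le_prod (fun j _ => Finset.sum_nonneg fun k _ => h0 k)
          fun j _ => ha.sum_le_tsum _ fun k _ => h0 k

theorem summable_inv_one_add_sq : Summable fun k : ℤ => (1 + (2 * Real.pi * k) ^ 2 : ℝ)⁻¹ := by
  refine Summable.of_norm_bounded_eventually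
    (Real.summable_one_div_int_pow (p := 2) |>.2 one_lt_two) ?_
  have : ∀ᶠ k : ℤ in cofinite, k ≠ 0 := by
    simpa using (Set.finite_singleton (0 : ℤ)).compl_mem_cofinite
  filter_upwards [this] with k hk
  rw [Real.norm_of_nonneg (by positivity), one_div]
  have hk' : (0 : ℝ) < (k : ℝ) ^ 2 := by positivity
  apply inv_anti₀ hk'
  have : (1 : ℝ) ≤ (2 * Real.pi) ^ 2 := by nlinarith [Real.pi_gt_three]
  nlinarith

theorem IsSmooth.summable_mFourierCoeff {f : UnitAddTorus d → ℂ} (hf : IsSmooth f) :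
    Summable (mFourierCoeff f) := by
  obtain ⟨g, hg, h⟩ := hf.exists_mFourierCoeff_mul Finset.univ
  obtain ⟨K, hK⟩ := isCompact_univ.exists_bound_of_continuousOn hg.continuous.continuousOn
  refine Summable.of_norm_bounded ((summable_pi_prod (d := d)
    (a := fun k : ℤ => (1 + (2 * Real.pi * k) ^ 2 : ℝ)⁻¹)
    (fun k => by positivity) summable_inv_one_add_sq).mul_left K) fun m => ?_
  have hb : ‖mFourierCoeff g m‖ ≤ K := by
    rw [mFourierCoeff_eq]
    refine (norm_integral_le_of_norm_le_const (C := K) (Eventually.of_forall fun t => ?_)).trans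
      (by simp)
    exact (norm_mFourier_mul_le _ _ _).trans (hK t (Set.mem_univ t))
  have hpos : 0 < ∏ j, (1 + (2 * Real.pi * m j) ^ 2 : ℝ) :=
    Finset.prod_pos fun j _ => by positivity
  rw [h, norm_mul, Complex.norm_real, Real.norm_of_nonneg hpos.le] at hb
  rw [Finset.prod_inv_distrib, ← div_eq_mul_inv, le_div_iff₀ hpos, mul_comm]
  exact hb

/-- A smooth function on the torus is the sum of its Fourier series at each point. -/
theorem IsSmooth.hasSum {f : UnitAddTorus d → ℂ} (hf : IsSmooth f) (t : UnitAddTorus d) :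
    HasSum (fun m => mFourierCoeff f m * mFourier m t) (f t) :=
  hasSum_mFourier_series_apply_of_summable (f := ⟨f, hf.continuous⟩) hf.summable_mFourierCoeff t

end TorusFourier

end

noncomputable section

/-! ### Absolutely convergent almost periodic functions -/

namespace BEmbedding

theorem norm_cexp_I_mul (w c : ℝ) : ‖Complex.exp (Complex.I * w * c)‖ = 1 := by
  have : Complex.I * w * c = ((w * c : ℝ) : ℂ) * Complex.I := by push_cast; ring
  rw [this, Complex.norm_exp_ofReal_mul_I]

/-- `φ(c) = ∑ a(w) e^{iwc}` with an absolutely summable family of coefficients. -/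
def HasBohrSeries (φ a : ℝ → ℂ) : Prop :=
  Summable a ∧ ∀ c : ℝ, HasSum (fun w : ℝ => a w * Complex.exp (Complex.I * w * c)) (φ c)

/-- Different indices may share a frequency, as happens for edges with rationally dependent lengths,
so coefficients are collected over the fibres of `ν`. -/
theorem hasBohrSeries_of_hasSum {ι : Type*} {α : ι → ℂ} {ν : ι → ℝ} {φ : ℝ → ℂ}
    (hα : Summable α)
    (h : ∀ c : ℝ, HasSum (fun i => α i * Complex.exp (Complex.I * ν i * c)) (φ c)) :
    HasBohrSeries φ fun w => ∑' i : {i // ν i = w}, α i := by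
  have hs : Summable fun x : Σ w, {i // ν i = w} => α x.2 :=
    (Equiv.sigmaFiberEquiv ν).summable_iff.2 hα
  refine ⟨hs.sigma, fun c => ?_⟩
  have hc := (Equiv.sigmaFiberEquiv ν).hasSum_iff.2 (h c)
  refine hc.sigma fun w => ?_
  have hw : (fun i : {i // ν i = w} =>
      ((fun i => α i * Complex.exp (Complex.I * ν i * c)) ∘ Equiv.sigmaFiberEquiv ν) ⟨w, i⟩) =
      fun i : {i // ν i = w} => α i * Complex.exp (Complex.I * w * c) := by
    funext i
    simp [Equiv.sigmaFiberEquiv, i.2]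
  rw [hw]
  exact (hs.sigma_factor w).hasSum.mul_right _

/-- The mean of `e^{iuc}` over `[-R, R]`. -/
def expMean (u R : ℝ) : ℂ :=
  ((2 * R : ℝ) : ℂ)⁻¹ * ∫ c in (-R)..R, Complex.exp (Complex.I * u * c)

theorem norm_expMean_le (u : ℝ) {R : ℝ} (hR : 0 < R) : ‖expMean u R‖ ≤ 1 := by
  have h := intervalIntegral.norm_integral_le_of_norm_le_const (a := -R) (b := R) (C := 1)
    (f := fun c : ℝ => Complex.exp (Complex.I * u * c)) fun c _ => (norm_cexp_I_mul u c).le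
  rw [expMean, norm_mul, norm_inv, Complex.norm_real, Real.norm_of_nonneg (by positivity),
    inv_mul_le_iff₀ (by positivity)]
  rw [abs_of_nonneg (by linarith)] at h
  linarith

theorem tendsto_expMean (u : ℝ) :
    Tendsto (expMean u) atTop (𝓝 (if u = 0 then 1 else 0)) := by
  split_ifs with hu
  · refine tendsto_const_nhds.congr' ?_
    filter_upwards [eventually_gt_atTop 0] with R hR
    have : (R : ℂ) ≠ 0 := by exact_mod_cast hR.ne'
    simp only [expMean, hu, Complex.ofReal_zero, mul_zero, zero_mul, Complex.exp_zero,
      intervalIntegral.integral_const, sub_neg_eq_add, Complex.real_smul, mul_one]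
    push_cast
    field_simp
    ring
  · have hu' : Complex.I * u ≠ 0 := by simp [hu]
    refine squeeze_zero_norm' (a := fun R => |u|⁻¹ * R⁻¹) ?_ ?_
    · filter_upwards [eventually_gt_atTop 0] with R hR
      rw [expMean, integral_exp_mul_complex hu', norm_mul, norm_div, norm_inv, Complex.norm_real,
        Real.norm_of_nonneg (by positivity), norm_mul, Complex.norm_I, one_mul, Complex.norm_real,
        Real.norm_eq_abs]
      have h2 := norm_sub_le (Complex.exp (Complex.I * u * R))
        (Complex.exp (Complex.I * u * (-R : ℝ)))
      rw [norm_cexp_I_mul, norm_cexp_I_mul] at h2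
      have hu0 : 0 < |u| := abs_pos.2 hu
      calc (2 * R)⁻¹ * (_ / |u|) ≤ (2 * R)⁻¹ * ((1 + 1) / |u|) := by gcongr
        _ = |u|⁻¹ * R⁻¹ := by field_simp; norm_num
    · simpa using tendsto_inv_atTop_zero.const_mul |u|⁻¹

/-- Absolute summability lets the sum be exchanged with the integral and then with the limit of the
means, where only the frequency `w` survives. -/
theorem HasBohrSeries.bohrCoeff {φ a : ℝ → ℂ} (h : HasBohrSeries φ a) : bohrCoeff φ = a := by
  funext w
  -- Integrating the series termwise requires a countable index set, so the sum over all real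
  -- frequencies is cut down to the support.
  have : Countable (Function.support a) := h.1.countable_support
  have hsa : Summable fun v : Function.support a => ‖a v‖ := h.1.norm.subtype _
  have hmean : ∀ R : ℝ, 0 < R → HasSum (fun v : Function.support a => a v * expMean (v - w) R)
      (((2 * R : ℝ) : ℂ)⁻¹ * ∫ c in (-R)..R, φ c * Complex.exp (-(Complex.I * w * c))) := by
    intro R hR
    have hI := intervalIntegral.hasSum_integral_of_dominated_convergence (μ := volume)
      (a := -R) (b := R) (f := fun c => φ c * Complex.exp (-(Complex.I * w * c)))
      (F := fun (v : Function.support a) (c : ℝ) =>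
        a v * Complex.exp (Complex.I * ((v - w : ℝ) : ℂ) * c))
      (fun v _ => ‖a v‖)
      (fun v => Continuous.aestronglyMeasurable (by fun_prop))
      (fun v => Eventually.of_forall fun c _ => by rw [norm_mul, norm_cexp_I_mul, mul_one])
      (Eventually.of_forall fun c _ => hsa)
      intervalIntegrable_const
      (Eventually.of_forall fun c _ => by
        have hS := (hasSum_subtype_iff_of_support_subset (s := Function.support a)
          (f := fun v => a v * Complex.exp (Complex.I * v * c))
          (Function.support_mul_subset_left _ _)).2 (h.2 c)
        have hE : (fun v : Function.support a =>
            a v * Complex.exp (Complex.I * ((v - w : ℝ) : ℂ) * c)) =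
            fun v : Function.support a => a v * Complex.exp (Complex.I * (v : ℝ) * c) *
              Complex.exp (-(Complex.I * w * c)) := by
          funext v
          rw [mul_assoc (a v), ← Complex.exp_add]
          push_cast
          ring_nf
        rw [hE]
        exact hS.mul_right _)
    have hE : (fun v : Function.support a => a v * expMean (v - w) R) =
        fun v : Function.support a =>
        ((2 * R : ℝ) : ℂ)⁻¹ * ∫ c in (-R)..R,
          a v * Complex.exp (Complex.I * ((v - w : ℝ) : ℂ) * c) := by
      funext v
      rw [intervalIntegral.integral_const_mul, expMean, mul_left_comm]
    rw [hE]
    exact hI.mul_left _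
  have hlim := tendsto_tsum_of_dominated_convergence (𝓕 := atTop)
    (f := fun (R : ℝ) (v : Function.support a) => a v * expMean (v - w) R)
    (g := fun v => a v * if (v : ℝ) - w = 0 then 1 else 0) hsa
    (fun v => (tendsto_expMean _).const_mul _)
    (by
      filter_upwards [eventually_gt_atTop 0] with R hR v
      rw [norm_mul]
      exact mul_le_of_le_one_right (norm_nonneg _) (norm_expMean_le _ hR))
  have hval : ∑' v : Function.support a, a v * (if (v : ℝ) - w = 0 then (1 : ℂ) else 0) = a w := by
    rw [tsum_subtype_eq_of_support_subset (f := fun v => a v * if v - w = 0 then (1 : ℂ) else 0)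
      (Function.support_mul_subset_left _ _), tsum_eq_single w]
    · simp
    · intro v hv
      simp [sub_eq_zero, hv]
  rw [hval] at hlim
  refine (hlim.congr' ?_).limUnder_eq
  filter_upwards [eventually_gt_atTop 0] with R hR
  exact (hmean R hR).tsum_eq

theorem HasBohrSeries.unique_fun {φ ψ a : ℝ → ℂ} (hφ : HasBohrSeries φ a)
    (hψ : HasBohrSeries ψ a) : φ = ψ :=
  funext fun c => (hφ.2 c).unique (hψ.2 c)

theorem HasBohrSeries.add {φ ψ a b : ℝ → ℂ} (hφ : HasBohrSeries φ a) (hψ : HasBohrSeries ψ b) :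
    HasBohrSeries (φ + ψ) (a + b) :=
  ⟨hφ.1.add hψ.1, fun c => by
    simpa only [Pi.add_apply, add_mul] using (hφ.2 c).add (hψ.2 c)⟩

theorem HasBohrSeries.smul {φ a : ℝ → ℂ} (k : ℂ) (hφ : HasBohrSeries φ a) :
    HasBohrSeries (k • φ) (k • a) :=
  ⟨hφ.1.const_smul k, fun c => by
    simpa only [Pi.smul_apply, smul_eq_mul, mul_assoc] using (hφ.2 c).mul_left k⟩

theorem HasBohrSeries.expNegS {φ a : ℝ → ℂ} (h : HasBohrSeries φ a) (b : ℝ) {CS : ℝ → ℝ}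
    (hCS : ∀ p, 0 ≤ CS p) :
    HasBohrSeries (expNegS b CS φ) fun w => (Real.exp (-CS (b * w / 3)) : ℂ) * a w := by
  have hle : ∀ w, ‖(Real.exp (-CS (b * w / 3)) : ℂ) * a w‖ ≤ ‖a w‖ := fun w => by
    rw [norm_mul, Complex.norm_real, Real.norm_of_nonneg (Real.exp_pos _).le]
    exact mul_le_of_le_one_left (norm_nonneg _) (Real.exp_le_one_iff.2 (by linarith [hCS (b * w / 3)]))
  have hs : Summable fun w => (Real.exp (-CS (b * w / 3)) : ℂ) * a w :=
    Summable.of_norm_bounded h.1.norm hle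
  refine ⟨hs, fun c => ?_⟩
  unfold BEmbedding.expNegS
  rw [h.bohrCoeff]
  refine (Summable.of_norm_bounded hs.norm fun w => ?_).hasSum
  rw [norm_mul _ (Complex.exp _), norm_cexp_I_mul, mul_one]

theorem expNegS_add {φ ψ a a' : ℝ → ℂ} (h : HasBohrSeries φ a) (h' : HasBohrSeries ψ a') (b : ℝ)
    {CS : ℝ → ℝ} (hCS : ∀ p, 0 ≤ CS p) :
    expNegS b CS (φ + ψ) = expNegS b CS φ + expNegS b CS ψ := by
  refine ((h.add h').expNegS b hCS).unique_fun ?_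
  convert (h.expNegS b hCS).add (h'.expNegS b hCS) using 1
  funext w
  simp [mul_add]

theorem expNegS_smul {φ a : ℝ → ℂ} (h : HasBohrSeries φ a) (k : ℂ) (b : ℝ)
    {CS : ℝ → ℝ} (hCS : ∀ p, 0 ≤ CS p) :
    expNegS b CS (k • φ) = k • expNegS b CS φ := by
  refine ((h.smul k).expNegS b hCS).unique_fun ?_
  convert (h.expNegS b hCS).smul k using 1
  funext w
  simp [mul_left_comm]

/-- The damping factors never vanish, so the coefficients, and with them the function, can be read
off from the image. -/
theorem expNegS_injective {φ ψ a a' : ℝ → ℂ} (h : HasBohrSeries φ a) (h' : HasBohrSeries ψ a')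
    {b : ℝ} {CS : ℝ → ℝ} (hCS : ∀ p, 0 ≤ CS p) (heq : expNegS b CS φ = expNegS b CS ψ) :
    φ = ψ := by
  have h1 := (h.expNegS b hCS).bohrCoeff
  rw [heq, (h'.expNegS b hCS).bohrCoeff] at h1
  have h2 : a' = a := funext fun w =>
    mul_left_cancel₀ (Complex.ofReal_ne_zero.2 (Real.exp_pos _).ne') (congrFun h1 w)
  exact h.unique_fun (h2 ▸ h')

end BEmbedding

end

noncomputable section

namespace BEmbedding

/-! ### Invariant fields -/

theorem IsSymmetric.smul {X : SmoothField ℝ} (hX : IsSymmetric X) (c : ℝ) :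
    IsSymmetric (c • X) := by
  intro v r
  have h := hX v r
  funext y i a
  have h' := congrFun (congrFun (congrFun h y) i) a
  simp only [euclAct] at h' ⊢
  simp only [Submodule.coe_smul, Pi.smul_apply, smul_eq_mul]
  rw [← h', Finset.mul_sum]
  refine Finset.sum_congr rfl fun j _ => ?_
  rw [Finset.mul_sum]
  exact Finset.sum_congr rfl fun b _ => by ring

theorem isSymmetric_zero : IsSymmetric (0 : SmoothField ℝ) := by
  intro v r
  funext y i a
  simp [euclAct]

theorem mem_specialOrthogonalGroup_of_det_eq_one {A : Matrix (Fin 3) (Fin 3) ℝ}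
    (h : A * A.transpose = 1) (hd : A.det = 1) : A ∈ Matrix.specialOrthogonalGroup (Fin 3) ℝ := by
  rw [Matrix.mem_specialOrthogonalGroup_iff]
  exact ⟨(Matrix.mem_orthogonalGroup_iff (Fin 3) ℝ).2 h, hd⟩

/-- An invariant field is a constant multiple of `δ^i_a`. -/
theorem IsSymmetric.exists_eq_delta {X : SmoothField ℝ} (hX : IsSymmetric X) :
    ∃ k : ℝ, ∀ x i a, X.1 x i a = if i = a then k else 0 := by
  have htrans : ∀ x, X.1 x = X.1 0 := by
    intro x
    funext i a
    have h := congrFun (congrFun (congrFun (hX x 1) x) i) a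
    simp only [euclAct, OneMemClass.coe_one, Matrix.transpose_one, Matrix.one_mulVec,
      sub_self, Matrix.one_apply] at h
    rw [← h]
    simp
  have hrot : ∀ A : Matrix (Fin 3) (Fin 3) ℝ, A * A.transpose = 1 → A.det = 1 → ∀ i a,
      ∑ j, ∑ b, A i j * A a b * X.1 0 j b = X.1 0 i a := by
    intro A hA hd i a
    have h := congrFun (congrFun (congrFun
      (hX 0 ⟨A, mem_specialOrthogonalGroup_of_det_eq_one hA hd⟩) 0) i) a
    simpa [euclAct] using h
  -- Two half turns kill the off-diagonal entries; the cyclic permutation of the axes equates the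
  -- diagonal ones.
  have h1 := hrot !![1, 0, 0; 0, -1, 0; 0, 0, -1]
    (by ext i j; fin_cases i <;> fin_cases j <;> simp [Matrix.mul_apply, Fin.sum_univ_three])
    (by simp [Matrix.det_fin_three])
  have h2 := hrot !![-1, 0, 0; 0, -1, 0; 0, 0, 1]
    (by ext i j; fin_cases i <;> fin_cases j <;> simp [Matrix.mul_apply, Fin.sum_univ_three])
    (by simp [Matrix.det_fin_three])
  have h3 := hrot !![0, 0, 1; 1, 0, 0; 0, 1, 0]
    (by ext i j; fin_cases i <;> fin_cases j <;> simp [Matrix.mul_apply, Fin.sum_univ_three])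
    (by simp [Matrix.det_fin_three])
  simp only [Fin.sum_univ_three] at h1 h2 h3
  refine ⟨X.1 0 0 0, fun x i a => ?_⟩
  rw [htrans x]
  have a01 := h1 0 1
  have a02 := h1 0 2
  have a10 := h1 1 0
  have a20 := h1 2 0
  have a12 := h2 1 2
  have a21 := h2 2 1
  have d1 := h3 1 1
  have d2 := h3 2 2
  simp at a01 a02 a10 a20 a12 a21 d1 d2
  fin_cases i <;> fin_cases a <;> simp <;> linarith

/-! ### Holonomies of homogeneous isotropic connections -/

/-- Since `hol` is a chosen solution, this needs uniqueness. For any transport `h`, the product `H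
(-u) * h u` has zero derivative because `N` is constant and commutes with `H`; taking `h = H` also
shows that `H (-1)` inverts `H 1`. -/
theorem hol_eq_of_commute {Z : ConnC} {e : Edge} {N : Matrix (Fin 2) (Fin 2) ℂ}
    (hN : ∀ t, pullback Z e t = N) {H : ℝ → Matrix (Fin 2) (Fin 2) ℂ} (hH : IsTransport Z e H)
    (hc : ∀ t, Commute N (H t)) : hol Z e = H 1 := by
  have key : ∀ h, IsTransport Z e h → H (-1) * h 1 = 1 := by
    intro h hh
    have hder : ∀ j k t, HasDerivAt (fun u => (H (-u) * h u) j k) 0 t := by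
      intro j k t
      have h1 : ∀ l, HasDerivAt (fun u => H (-u) j l * h u l k)
          (-(N * H (-t)) j l * h t l k + H (-t) j l * (N * h t) l k) t := by
        intro l
        have ha := (hH.2 (-t) j l).scomp t (hasDerivAt_neg t)
        have hb := hh.2 t l k
        rw [hN] at ha hb
        simpa [Function.comp_def] using ha.fun_mul hb
      have h2 := HasDerivAt.fun_sum (u := Finset.univ) fun l _ => h1 l
      have h3 : ∑ l, (-(N * H (-t)) j l * h t l k + H (-t) j l * (N * h t) l k) = 0 := by
        have : (-(N * H (-t)) * h t + H (-t) * (N * h t)) j k = 0 := by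
          rw [(hc (-t)).eq, neg_mul, Matrix.mul_assoc, neg_add_cancel]
          rfl
        rw [← this, Matrix.add_apply, Matrix.mul_apply, Matrix.mul_apply, Finset.sum_add_distrib]
        rfl
      rw [h3] at h2
      exact h2
    ext j k
    have := is_const_of_deriv_eq_zero (𝕜 := ℝ) (f := fun u => (H (-u) * h u) j k)
      (fun t => (hder j k t).differentiableAt) (fun t => (hder j k t).deriv) 1 0
    simpa [hH.1, hh.1] using this
  have hex : ∃ h, IsTransport Z e h := ⟨H, hH⟩
  rw [hol, dif_pos hex]
  have h1 := key _ hex.choose_spec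
  have h2 := mul_eq_one_comm.1 (key H hH)
  calc hex.choose 1 = (H 1 * H (-1)) * hex.choose 1 := by rw [h2, one_mul]
    _ = H 1 := by rw [Matrix.mul_assoc, h1, mul_one]

/-- The element `u^i τ_i` of `su(2)`. -/
def suGen (u : Space) : Matrix (Fin 2) (Fin 2) ℂ := ∑ i, (u i : ℂ) • tau i

/-- The frequency `|u| / 2` of the one-parameter group generated by `u^i τ_i`. -/
def suFreq (u : Space) : ℝ := √(u 0 ^ 2 + u 1 ^ 2 + u 2 ^ 2) / 2

theorem suGen_eq (u : Space) : suGen u =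
    !![-(Complex.I / 2) * u 2, -(Complex.I / 2) * (u 0 - Complex.I * u 1);
      -(Complex.I / 2) * (u 0 + Complex.I * u 1), Complex.I / 2 * u 2] := by
  ext i j
  fin_cases i <;> fin_cases j <;> simp [suGen, tau, Fin.sum_univ_three] <;> ring

theorem suFreq_sq (u : Space) : (suFreq u) ^ 2 = (u 0 ^ 2 + u 1 ^ 2 + u 2 ^ 2) / 4 := by
  rw [suFreq, div_pow, Real.sq_sqrt (by positivity)]
  norm_num

theorem suFreq_sq_complex (u : Space) :
    (suFreq u : ℂ) ^ 2 = ((u 0 : ℂ) ^ 2 + (u 1 : ℂ) ^ 2 + (u 2 : ℂ) ^ 2) / 4 := by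
  exact_mod_cast suFreq_sq u

theorem suFreq_ne_zero {u : Space} (hu : u ≠ 0) : suFreq u ≠ 0 := by
  intro h
  have h2 := suFreq_sq u
  rw [h] at h2
  apply hu
  funext i
  have : u i ^ 2 = 0 := by
    fin_cases i <;> simp only [Fin.zero_eta, Fin.mk_one, Fin.reduceFinMk] <;>
      nlinarith [sq_nonneg (u 0), sq_nonneg (u 1), sq_nonneg (u 2)]
  exact pow_eq_zero_iff two_ne_zero |>.1 this

/-- The square is a scalar, which is why the exponential closes up into a cosine and a sine as in
Euler's formula. -/
theorem suGen_mul_self (u : Space) : suGen u * suGen u = (-(suFreq u : ℂ) ^ 2) • 1 := by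
  rw [suFreq_sq_complex, suGen_eq]
  ext i j
  fin_cases i <;> fin_cases j <;>
    simp [Matrix.mul_apply, Fin.sum_univ_two] <;> ring_nf <;> simp [Complex.I_sq] <;> ring

/-- `C + (S / λ) u^i τ_i` where `λ` is the frequency of `u`; for `C = cos θ`, `S = sin θ` it is
`exp ((θ / λ) u^i τ_i)`. -/
def suRot (u : Space) (C S : ℂ) : Matrix (Fin 2) (Fin 2) ℂ := C • 1 + (S / suFreq u) • suGen u

theorem suRot_det {u : Space} (hu : u ≠ 0) {C S : ℂ} (h : C ^ 2 + S ^ 2 = 1) :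
    (suRot u C S).det = 1 := by
  have hl : (suFreq u : ℂ) ≠ 0 := Complex.ofReal_ne_zero.2 (suFreq_ne_zero hu)
  have hs := suFreq_sq_complex u
  rw [suRot, suGen_eq, Matrix.det_fin_two]
  simp
  generalize (suFreq u : ℂ) = l at hl hs ⊢
  obtain ⟨T, rfl⟩ : ∃ T, S = T * l := ⟨S / l, by field_simp⟩
  rw [mul_div_assoc, div_self hl, mul_one]
  linear_combination h + (-T ^ 2 * ((u 0 : ℂ) ^ 2 + (u 1 : ℂ) ^ 2 * (1 - Complex.I ^ 2)
    + (u 2 : ℂ) ^ 2) / 4) * Complex.I_sq - T ^ 2 * hs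

theorem suRot_mem {u : Space} (hu : u ≠ 0) {C S : ℝ} (h : C ^ 2 + S ^ 2 = 1) :
    suRot u C S ∈ Matrix.specialUnitaryGroup (Fin 2) ℂ := by
  have hc : (C : ℂ) ^ 2 + (S : ℂ) ^ 2 = 1 := by exact_mod_cast h
  rw [Matrix.mem_specialUnitaryGroup_iff]
  refine ⟨?_, suRot_det hu hc⟩
  rw [Matrix.mem_unitaryGroup_iff]
  have hstar : star (suRot u C S) = suRot u C (-S) := by
    rw [suRot, suRot, suGen_eq]
    ext i j
    fin_cases i <;> fin_cases j <;> simp [Matrix.star_apply] <;> ring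
  have hl : (suFreq u : ℂ) ≠ 0 := Complex.ofReal_ne_zero.2 (suFreq_ne_zero hu)
  rw [hstar, suRot, suRot, add_mul, mul_add, mul_add, smul_mul_smul_comm, smul_mul_smul_comm,
    smul_mul_smul_comm, smul_mul_smul_comm, suGen_mul_self, one_mul, one_mul, mul_one, smul_smul]
  have h1 : (C : ℂ) * (-S / suFreq u) = -(S / suFreq u * C) := by ring
  have h2 : (S : ℂ) / suFreq u * (-S / suFreq u) * (-(suFreq u : ℂ) ^ 2) = S * S := by
    field_simp
  rw [h1, h2, neg_smul, add_assoc, neg_add_cancel_left, ← add_smul, ← sq, ← sq, hc, one_smul]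

variable {A₀ : Conn} {k : ℝ}

/-- Along a straight edge the generator is constant, so the transport is a one-parameter group.
Complex `z` is allowed so that the same formula serves `U` and `Cyl_S`. -/
theorem hol_smul_toC (hA : ∀ x i a, A₀.1 x i a = if i = a then k else 0) {e : Edge} {u : Space}
    (hu : u = k • (e.tgt - e.src)) (hu0 : u ≠ 0) (z : ℂ) :
    hol (z • toC A₀) e = suRot u (Complex.cos (suFreq u * z)) (Complex.sin (suFreq u * z)) := by
  have hl : (suFreq u : ℂ) ≠ 0 := Complex.ofReal_ne_zero.2 (suFreq_ne_zero hu0)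
  have hN : ∀ t, pullback (z • toC A₀) e t = z • suGen u := by
    intro t
    simp only [pullback, suGen, Finset.smul_sum]
    refine Finset.sum_congr rfl fun i _ => ?_
    rw [Finset.sum_eq_single i]
    · simp [toC, hA, hu, smul_smul]
      ring_nf
    · intro a _ hai
      simp [toC, hA, hai.symm]
    · simp
  have := hol_eq_of_commute hN (H := fun t => suRot u (Complex.cos (suFreq u * z * t))
    (Complex.sin (suFreq u * z * t))) ⟨by simp [suRot], fun t j l => ?_⟩ fun t => ?_
  · simpa using this
  · rw [hN]
    have hlin : HasDerivAt (fun t : ℂ => (suFreq u : ℂ) * z * t) (suFreq u * z * 1) (t : ℂ) :=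
      (hasDerivAt_id (t : ℂ)).const_mul _
    have hcos := hlin.ccos.comp_ofReal
    have hsin := hlin.csin.comp_ofReal
    have hd := (hcos.mul_const ((1 : Matrix (Fin 2) (Fin 2) ℂ) j l)).add
      ((hsin.div_const (suFreq u : ℂ)).mul_const (suGen u j l))
    have hprod : z • suGen u * suRot u (Complex.cos (suFreq u * z * t))
        (Complex.sin (suFreq u * z * t)) =
        (-(suFreq u * z * Complex.sin (suFreq u * z * t))) • 1 +
          (z * Complex.cos (suFreq u * z * t)) • suGen u := by
      rw [suRot, mul_add, smul_mul_smul_comm, smul_mul_smul_comm, suGen_mul_self, mul_one,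
        smul_smul, add_comm]
      congr 2
      field_simp
    rw [hprod]
    refine HasDerivAt.congr_deriv hd ?_
    simp only [Matrix.add_apply, Matrix.smul_apply, smul_eq_mul]
    field_simp
  · rw [suRot]
    exact ((Commute.one_right _).smul_right _).add_right
      (((Commute.refl _).smul_left _).smul_right _)

end BEmbedding

end

/-! ### Cylindrical functions restricted to the line of multiples of `A₀` -/

noncomputable section

namespace BEmbedding

variable {A₀ : Conn} {k : ℝ}

theorem toC_smul (c : ℝ) (X : SmoothField ℝ) : toC (c • X) = (c : ℂ) • toC X := by
  ext x i a
  simp [toC]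

theorem smul_edge_ne_zero (hk : k ≠ 0) (e : Edge) : k • (e.tgt - e.src) ≠ 0 :=
  smul_ne_zero hk (sub_ne_zero.2 e.ne.symm)

/-- Holomorphic cylindrical functions are entire along `z ↦ z A₀`. -/
theorem IsHolCyl.differentiable_smul (hk : k ≠ 0)
    (hA : ∀ x i a, A₀.1 x i a = if i = a then k else 0) {Ψ : ConnC → ℂ} (hΨ : IsHolCyl Ψ) :
    Differentiable ℂ fun z : ℂ => Ψ (z • toC A₀) := by
  obtain ⟨n, e, F, hF, h⟩ := hΨ
  set u : Fin n → Space := fun j => k • ((e j).tgt - (e j).src)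
  have hu0 : ∀ j, u j ≠ 0 := fun j => smul_edge_ne_zero hk _
  have hΨz : (fun z : ℂ => Ψ (z • toC A₀)) = fun z => F fun j =>
      suRot (u j) (Complex.cos (suFreq (u j) * z)) (Complex.sin (suFreq (u j) * z)) := by
    funext z
    rw [h]
    congr 1
    funext j
    exact hol_smul_toC hA rfl (hu0 j) z
  rw [hΨz]
  intro z
  refine DifferentiableAt.comp (F := Tuple n) z (hF _ fun j => ?_).differentiableAt ?_
  · exact suRot_det (hu0 j) (Complex.cos_sq_add_sin_sq _)
  · refine differentiableAt_pi (F' := fun _ => Fin 2 → Fin 2 → ℂ) |>.2 fun j =>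
      differentiableAt_pi.2 fun a => differentiableAt_pi.2 fun c => ?_
    simp only [suRot, Matrix.add_apply, Matrix.smul_apply, smul_eq_mul]
    fun_prop

/-- Reduced cylindrical functions are absolutely convergent almost periodic functions. -/
theorem exists_hasBohrSeries_of_mem_CylS (hk : k ≠ 0)
    (hA : ∀ x i a, A₀.1 x i a = if i = a then k else 0) {φ : ℝ → ℂ} (hφ : φ ∈ CylS A₀) :
    ∃ a, HasBohrSeries φ a := by
  obtain ⟨Φ, ⟨n, e, F, hF, h⟩, rfl⟩ := hφ
  set u : Fin n → Space := fun j => k • ((e j).tgt - (e j).src)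
  have hu0 : ∀ j, u j ≠ 0 := fun j => smul_edge_ne_zero hk _
  -- Each edge gets an independent angle. For real angles the arguments of `F` stay in `SU(2)ⁿ`,
  -- where `F` is analytic, so `f` is smooth.
  let f : UnitAddTorus (Fin n) → ℂ := fun θ => F fun j =>
    suRot (u j) ((fourier 1 (θ j) : ℂ).re : ℂ) ((fourier 1 (θ j) : ℂ).im : ℂ)
  have hf1 : ∀ x : Fin n → ℝ, f (TorusFourier.proj x) = F fun j =>
      suRot (u j) (Real.cos (2 * Real.pi * x j) : ℝ) (Real.sin (2 * Real.pi * x j) : ℝ) := by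
    intro x
    have hexp : ∀ y : ℝ, (fourier 1 (y : UnitAddCircle) : ℂ) =
        Complex.exp (((2 * Real.pi * y : ℝ) : ℂ) * Complex.I) := by
      intro y
      rw [fourier_coe_apply]
      congr 1
      push_cast
      ring
    simp only [f, TorusFourier.proj, hexp, Complex.exp_ofReal_mul_I_re,
      Complex.exp_ofReal_mul_I_im]
  have hf : TorusFourier.IsSmooth f := by
    unfold TorusFourier.IsSmooth
    simp only [hf1]
    refine contDiff_iff_contDiffAt.2 fun x => ?_
    refine ContDiffAt.comp (F := Tuple n) x (hF _ fun j => ?_).contDiffAt ?_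
    · exact suRot_mem (hu0 j) (Real.cos_sq_add_sin_sq _)
    · refine contDiffAt_pi (F' := fun _ => Fin 2 → Fin 2 → ℂ) |>.2 fun j =>
        contDiffAt_pi.2 fun a => contDiffAt_pi.2 fun c => ?_
      simp only [suRot, Matrix.add_apply, Matrix.smul_apply, smul_eq_mul, div_eq_mul_inv]
      have hx : ContDiffAt ℝ ∞ (fun x : Fin n → ℝ => 2 * Real.pi * x j) x := by fun_prop
      have hc : ContDiffAt ℝ ∞ (fun x : Fin n → ℝ => (Real.cos (2 * Real.pi * x j) : ℂ)) x :=
        Complex.ofRealCLM.contDiff.contDiffAt.comp x hx.cos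
      have hs : ContDiffAt ℝ ∞ (fun x : Fin n → ℝ => (Real.sin (2 * Real.pi * x j) : ℂ)) x :=
        Complex.ofRealCLM.contDiff.contDiffAt.comp x hx.sin
      exact (hc.mul contDiffAt_const).add ((hs.mul contDiffAt_const).mul contDiffAt_const)
  refine ⟨_, hasBohrSeries_of_hasSum (ι := Fin n → ℤ)
    (ν := fun m => ∑ j, m j * suFreq (u j)) hf.summable_mFourierCoeff fun c => ?_⟩
  -- The function of `c` is `f` along a straight line in the torus; the division by `2π` matches
  -- circles of length one, and the character `m` becomes a wave of frequency `∑ j, m j * suFreq (u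
  -- j)`.
  have hsum := hf.hasSum (TorusFourier.proj fun j => c * suFreq (u j) / (2 * Real.pi))
  have hval : f (TorusFourier.proj fun j => c * suFreq (u j) / (2 * Real.pi)) =
      LinearMap.funLeft ℂ ℂ (rMap A₀) Φ c := by
    rw [hf1, LinearMap.funLeft_apply, h]
    congr 1
    funext j
    have harg : 2 * Real.pi * (c * suFreq (u j) / (2 * Real.pi)) = suFreq (u j) * c := by
      field_simp
    rw [rMap, toC_smul, hol_smul_toC hA rfl (hu0 j) c, harg]
    push_cast
    rfl
  rw [hval] at hsum
  convert hsum using 2 with m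
  rw [TorusFourier.mFourier_proj]
  congr 2
  push_cast
  rw [Finset.mul_sum, Finset.mul_sum, Finset.sum_mul]
  refine Finset.sum_congr rfl fun j _ => ?_
  have : (Real.pi : ℂ) ≠ 0 := Complex.ofReal_ne_zero.2 Real.pi_ne_zero
  field_simp

/-- Entire functions that agree on the real line are equal. -/
theorem eq_of_eq_on_real {f g : ℂ → ℂ} (hf : Differentiable ℂ f) (hg : Differentiable ℂ g)
    (h : ∀ c : ℝ, f c = g c) : f = g := by
  refine AnalyticOnNhd.eq_of_frequently_eq (𝕜 := ℂ) (z₀ := 0)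
    (fun z _ => hf.analyticAt z) (fun z _ => hg.analyticAt z) ?_
  have ht : Tendsto (fun c : ℝ => (c : ℂ)) (𝓝[≠] 0) (𝓝[≠] 0) := by
    refine tendsto_nhdsWithin_iff.2 ⟨?_, ?_⟩
    · exact (Complex.continuous_ofReal.tendsto' 0 0 (by simp)).mono_left nhdsWithin_le_nhds
    · filter_upwards [self_mem_nhdsWithin] with c hc
      simpa using hc
  exact ht.frequently (Eventually.frequently (Eventually.of_forall h))

/-! ### The transforms -/

section Transforms

variable {T : StraightCyl →ₗ[ℂ] StraightCyl}

theorem holU_isContinuation (hU : ∀ Φ : StraightCyl, ∃ Ψ, IsContinuation (T Φ).1 Ψ)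
    (Φ : StraightCyl) : IsContinuation (T Φ).1 (holU T Φ) := by
  rw [holU, dif_pos (hU Φ)]
  exact (hU Φ).choose_spec

theorem holU_ofReal_smul (hU : ∀ Φ : StraightCyl, ∃ Ψ, IsContinuation (T Φ).1 Ψ)
    (Φ : StraightCyl) (c : ℝ) : holU T Φ ((c : ℂ) • toC A₀) = (T Φ).1 (c • A₀) := by
  rw [← toC_smul]
  exact (holU_isContinuation hU Φ).2 _

/-- `holU` picks a continuation separately for each `Φ`, so linearity is not automatic. On multiples
of `A₀` the identity theorem makes the choice irrelevant and carries linearity over from real `z`.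
-/
theorem holU_smul_isLinearMap (hk : k ≠ 0)
    (hA : ∀ x i a, A₀.1 x i a = if i = a then k else 0)
    (hU : ∀ Φ : StraightCyl, ∃ Ψ, IsContinuation (T Φ).1 Ψ) (z : ℂ) :
    IsLinearMap ℂ fun Φ : StraightCyl => holU T Φ (z • toC A₀) := by
  have hd : ∀ Φ, Differentiable ℂ fun z : ℂ => holU T Φ (z • toC A₀) := fun Φ =>
    (holU_isContinuation hU Φ).1.differentiable_smul hk hA
  constructor
  · intro Φ Φ'
    refine congrFun (eq_of_eq_on_real (hd (Φ + Φ')) ((hd Φ).add (hd Φ')) fun c => ?_) z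
    simp [holU_ofReal_smul hU]
  · intro r Φ
    refine congrFun (eq_of_eq_on_real (hd (r • Φ)) ((hd Φ).const_smul r) fun c => ?_) z
    simp [holU_ofReal_smul hU]

theorem holUS_isEntireExtension {b : ℝ} {CS : ℝ → ℝ} {φ : ℝ → ℂ}
    (h : ∃ f, IsEntireExtension (expNegS b CS φ) f) :
    IsEntireExtension (expNegS b CS φ) (holUS b CS φ) := by
  rw [holUS, dif_pos h]
  exact h.choose_spec

/-! ### The inclusion of the symmetric phase space -/

theorem funcDeriv_spec {C : Complexifier} {E : Triad} (h : ∃ D, HasFuncDeriv C E D) :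
    HasFuncDeriv C E (funcDeriv C E) := by
  rw [funcDeriv, dif_pos h]
  exact h.choose_spec

variable {b ℓ : ℝ} {C : Complexifier} {CS : ℝ → ℝ} {s : ℂ → ConnC}

theorem frakZ_zero_momentum (hCdiff : ∀ E : Triad, IsSymmetric E → ∃ D, HasFuncDeriv C E D)
    (hC0 : ∀ E D, HasFuncDeriv C E D → (D = 0 ↔ E = 0)) (A : Conn) :
    frakZ b C (A, 0) = toC A := by
  have h0 : funcDeriv C 0 = 0 :=
    (hC0 0 _ (funcDeriv_spec (hCdiff 0 isSymmetric_zero))).2 rfl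
  have h1 : toC (0 : SmoothField ℝ) = 0 := by
    ext x i a
    simp [toC]
  rw [frakZ, h0, h1, smul_zero, sub_zero]

/-- The holomorphic inclusion of the symmetric phase space is `z ↦ z A₀`. -/
theorem IsHolInclusion.eq_smul (hs : IsHolInclusion b ℓ A₀ C CS s) (hA₀ : IsSymmetric A₀)
    (hCdiff : ∀ E : Triad, IsSymmetric E → ∃ D, HasFuncDeriv C E D)
    (hC0 : ∀ E D, HasFuncDeriv C E D → (D = 0 ↔ E = 0))
    (hCS0 : ∀ p, deriv CS p = 0 ↔ p = 0) (z : ℂ) : s z = z • toC A₀ := by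
  have hreal : ∀ c : ℝ, s c = (c : ℂ) • toC A₀ := by
    intro c
    have h := hs.1 (c • A₀, 0) ⟨hA₀.smul c, isSymmetric_zero⟩ c 0 ⟨rfl, by simp⟩
    rw [frakZ_zero_momentum hCdiff hC0, toC_smul, redZ, (hCS0 0).2 rfl] at h
    simpa using h
  ext x i a
  refine congrFun (eq_of_eq_on_real (hs.2 x i a) (g := fun z => (z • toC A₀).1 x i a) ?_
    fun c => ?_) z
  · simp only [Submodule.coe_smul, Pi.smul_apply, smul_eq_mul]
    fun_prop
  · rw [hreal]

/-- Every symmetric pair has coordinates `(c, p)`. -/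
theorem exists_hasCoords (hℓ : 0 < ℓ) (hk : k ≠ 0)
    (hA : ∀ x i a, A₀.1 x i a = if i = a then k else 0) {ξ : Conn × Triad} (hξ : ξ ∈ symPhase) :
    ∃ c p, HasCoords ℓ A₀ ξ c p := by
  obtain ⟨kA, hkA⟩ := hξ.1.exists_eq_delta
  obtain ⟨kE, hkE⟩ := hξ.2.exists_eq_delta
  have hmat : ∀ x, (Matrix.of (A₀.1 x))⁻¹ = k⁻¹ • (1 : Matrix (Fin 3) (Fin 3) ℝ) := by
    intro x
    refine Matrix.inv_eq_right_inv ?_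
    have : Matrix.of (A₀.1 x) = k • (1 : Matrix (Fin 3) (Fin 3) ℝ) := by
      ext i a
      simp [hA, Matrix.one_apply]
    rw [this, smul_mul_smul_comm, mul_inv_cancel₀ hk, one_smul, one_mul]
  -- The reference densitized triad is itself a nonzero multiple of `δ`, so any invariant triad is a
  -- multiple of it.
  have href : ∀ x i a, refDensTriad ℓ A₀ x i a =
      if i = a then |(ℓ⁻¹ * k⁻¹) ^ 3|⁻¹ * (ℓ⁻¹ * k⁻¹) else 0 := by
    intro x i a
    simp only [refDensTriad, refTriad, hmat, smul_smul, Matrix.det_smul, Matrix.det_one, mul_one,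
      Fintype.card_fin, Matrix.smul_apply, Matrix.one_apply, smul_eq_mul, eq_comm (a := a)]
    split_ifs <;> simp
  have hq : |(ℓ⁻¹ * k⁻¹) ^ 3|⁻¹ * (ℓ⁻¹ * k⁻¹) ≠ 0 := by
    have : ℓ⁻¹ * k⁻¹ ≠ 0 := mul_ne_zero (inv_ne_zero hℓ.ne') (inv_ne_zero hk)
    exact mul_ne_zero (inv_ne_zero (abs_ne_zero.2 (pow_ne_zero 3 this))) this
  generalize |(ℓ⁻¹ * k⁻¹) ^ 3|⁻¹ * (ℓ⁻¹ * k⁻¹) = q at href hq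
  refine ⟨kA / k, kE * ℓ ^ 2 / q, ?_, fun x i a => ?_⟩
  · ext x i a
    simp only [Submodule.coe_smul, Pi.smul_apply, smul_eq_mul, hkA, hA]
    split_ifs <;> field_simp
    simp
  · rw [hkE, href]
    split_ifs
    · field_simp
    · simp

end Transforms

end BEmbedding

end

/-! ### Linearity, kernel and dual range of `π` -/

open BEmbedding in
theorem mainTheorem4
    -- Newton's constant, the Barbero-Immirzi parameter, and `b = 8πGγ`
    (G γ b : ℝ) (hG : 0 < G) (hγ : 0 < γ) (hb : b = 8 * Real.pi * G * γ)
    -- the reference length and the symmetric reference connection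
    (ℓ : ℝ) (hℓ : 0 < ℓ) (A₀ : Conn) (hA₀ : IsSymmetric A₀) (hA₀' : A₀ ≠ 0)
    -- the classical complexifiers, both functions of the momenta only, with derivatives that
    -- vanish only at zero momentum
    (C : Complexifier) (CS : ℝ → ℝ)
    (hCdiff : ∀ E : Triad, IsSymmetric E → ∃ D, HasFuncDeriv C E D)
    (hC0 : ∀ E D, HasFuncDeriv C E D → (D = 0 ↔ E = 0))
    (hCSnonneg : ∀ p, 0 ≤ CS p) (hCSdiff : Differentiable ℝ CS)
    (hCS0 : ∀ p, deriv CS p = 0 ↔ p = 0)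
    -- the quantum complexifier, and `T`, the action of `e^{-Ĉ}` on straight-edge Cyl
    (Chat : KinHilbert →ₗ.[ℂ] KinHilbert) (hChat : IsNonnegSelfAdjoint Chat)
    (T : StraightCyl →ₗ[ℂ] StraightCyl) (hT : IsExpNegOnCyl Chat T)
    -- the coherent states of both theories exist
    (hU : ∀ Φ : StraightCyl, ∃ Ψ, IsContinuation (T Φ).1 Ψ)
    (hUS : ∀ φ ∈ CylS A₀, ∃ f, IsEntireExtension (expNegS b CS φ) f)
    -- `s` is holomorphic, and `π` is defined on all of straight-edge Cyl
    (s : ℂ → ConnC) (hs : IsHolInclusion b ℓ A₀ C CS s)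
    (hπ : ∀ Φ : StraightCyl, ∃ φ ∈ CylS A₀, holUS b CS φ = fun z => holU T Φ (s z)) :
    (∀ ξ ∈ symPhase, IsLinearMap ℂ (coherentState T (frakZ b C ξ))) ∧
    ∃ hlin : IsLinearMap ℂ (piMap b A₀ CS T s),
      Set.range (iotaB hlin) =
        {Ψ : Module.Dual ℂ StraightCyl |
          ∀ Φ : StraightCyl, (∀ Z ∈ frakZ b C '' symPhase, holU T Φ Z = 0) → Ψ Φ = 0} ∧
      Set.range (iotaB hlin) =
        {Ψ : Module.Dual ℂ StraightCyl |
          ∀ Φ : StraightCyl, (∀ ξ ∈ symPhase, coherentState T (frakZ b C ξ) Φ = 0) →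
            Ψ Φ = 0} := by
  obtain ⟨k, hA⟩ := hA₀.exists_eq_delta
  have hk : k ≠ 0 := by
    rintro rfl
    apply hA₀'
    ext x i a
    simp [hA]
  have hs' : ∀ z, s z = z • toC A₀ := hs.eq_smul hA₀ hCdiff hC0 hCS0
  have hfrak : ∀ ξ ∈ symPhase, ∃ z : ℂ, frakZ b C ξ = z • toC A₀ := by
    intro ξ hξ
    obtain ⟨c, p, hcp⟩ := exists_hasCoords hℓ hk hA hξ
    exact ⟨redZ b CS c p, by rw [← hs', hs.1 ξ hξ c p hcp]⟩
  have hbohr : ∀ φ : CylS A₀, ∃ a, HasBohrSeries φ.1 a := fun φ =>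
    exists_hasBohrSeries_of_mem_CylS hk hA φ.2
  -- on the real line the defining equation of `π` reads `e^{-Ĉ_S} (π Φ) (c) = (e^{-Ĉ} Φ) (c A₀)`
  have hpi : ∀ Φ, holUS b CS (piMap b A₀ CS T s Φ).1 = fun z => holU T Φ (s z) := by
    intro Φ
    have hex : ∃ φ : CylS A₀, holUS b CS φ.1 = fun z => holU T Φ (s z) := by
      obtain ⟨φ, hφ, h⟩ := hπ Φ
      exact ⟨⟨φ, hφ⟩, h⟩
    rw [piMap, dif_pos hex]
    exact hex.choose_spec
  have hpiReal : ∀ Φ (c : ℝ),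
      expNegS b CS (piMap b A₀ CS T s Φ).1 c = (T Φ).1 (c • A₀) := by
    intro Φ c
    rw [← (holUS_isEntireExtension (hUS _ (piMap b A₀ CS T s Φ).2)).2 c, hpi]
    beta_reduce
    rw [hs', holU_ofReal_smul hU]
  have hlin : IsLinearMap ℂ (piMap b A₀ CS T s) := by
    constructor
    · intro Φ Φ'
      obtain ⟨a, ha⟩ := hbohr (piMap b A₀ CS T s (Φ + Φ'))
      obtain ⟨a₁, h₁⟩ := hbohr (piMap b A₀ CS T s Φ)
      obtain ⟨a₂, h₂⟩ := hbohr (piMap b A₀ CS T s Φ')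
      refine Subtype.ext (expNegS_injective ha (h₁.add h₂) hCSnonneg (b := b) ?_)
      rw [Submodule.coe_add, expNegS_add h₁ h₂ b hCSnonneg]
      funext c
      simp [hpiReal]
    · intro r Φ
      obtain ⟨a, ha⟩ := hbohr (piMap b A₀ CS T s (r • Φ))
      obtain ⟨a₁, h₁⟩ := hbohr (piMap b A₀ CS T s Φ)
      refine Subtype.ext (expNegS_injective ha (h₁.smul r) hCSnonneg (b := b) ?_)
      rw [Submodule.coe_smul, expNegS_smul h₁ r b hCSnonneg]
      funext c
      simp [hpiReal]
  have hker : ∀ Φ, piMap b A₀ CS T s Φ = 0 ↔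
      ∀ ξ ∈ symPhase, coherentState T (frakZ b C ξ) Φ = 0 := by
    intro Φ
    constructor
    · intro h0 ξ hξ
      obtain ⟨z, hz⟩ := hfrak ξ hξ
      -- Zero is written as `π 0`, so that `hpiReal` evaluates its transform on the real line.
      have hext := holUS_isEntireExtension (hUS _ (piMap b A₀ CS T s 0).2)
      have hzero : holUS b CS (piMap b A₀ CS T s 0).1 = fun _ => 0 := by
        refine eq_of_eq_on_real hext.1 (differentiable_const _) fun c => ?_
        rw [hext.2, hpiReal]
        simp
      have h1 := congrFun (hpi Φ) z
      rw [h0, ← hlin.map_zero, hzero, hs', ← hz] at h1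
      exact h1.symm
    · intro h0
      obtain ⟨a, ha⟩ := hbohr (piMap b A₀ CS T s Φ)
      obtain ⟨a', ha'⟩ := hbohr (piMap b A₀ CS T s 0)
      rw [← hlin.map_zero]
      refine Subtype.ext (expNegS_injective ha ha' hCSnonneg (b := b) ?_)
      funext c
      -- The symmetric points of zero momentum already suffice, since their labels are the real
      -- multiples of `A₀`.
      have h1 := h0 (c • A₀, 0) ⟨hA₀.smul c, isSymmetric_zero⟩
      rw [frakZ_zero_momentum hCdiff hC0, coherentState, toC_smul, holU_ofReal_smul hU] at h1
      simp [hpiReal, h1]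
  have hrange : Set.range (iotaB hlin) = {Ψ : Module.Dual ℂ StraightCyl |
      ∀ Φ : StraightCyl, (∀ ξ ∈ symPhase, coherentState T (frakZ b C ξ) Φ = 0) → Ψ Φ = 0} := by
    have h := LinearMap.range_dualMap_eq_dualAnnihilator_ker (hlin.mk' (piMap b A₀ CS T s))
    ext Ψ
    rw [← LinearMap.coe_range, iotaB, h, SetLike.mem_coe, Submodule.mem_dualAnnihilator]
    exact forall_congr' fun Φ => imp_congr_left (LinearMap.mem_ker.trans (hker Φ))
  refine ⟨fun ξ hξ => ?_, hlin, ?_, hrange⟩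
  · obtain ⟨z, hz⟩ := hfrak ξ hξ
    rw [hz]
    exact holU_smul_isLinearMap hk hA hU z
  · rw [hrange]
    simp only [Set.forall_mem_image, coherentState]
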